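/- A binary tree is a rooted tree in which every vertex has at most one left child and at most one right child. For a non-empty binary tree $B$, let $LV(B)$ and $RV(B)$ be the sets of its vertices that are left children, respectively right children. A non-ambiguous tree (NAT) of shape $B$ is a labelling of the non-root vertices of $B$ in which the left children carry pairwise distinct labels from $\{1,\dots,|LV(B)|\}$, the right children carry pairwise distinct labels from $\{1,\dots,|RV(B)|\}$, and whenever $U\neq V$ are two left children (or two right children) with $U$ an ancestor of $V$, the label of $U$ is strictly greater than the label of $V$. Its geometric size is $(w_L(T),w_R(T))=(|LV(B)|+1,|RV(B)|+1)$. By convention there are in addition two empty NATs $\emptyset_L$ and $\emptyset_R$, of geometric sizes $(0,1)$ and $(1,0)$ respectively. There are finitely many NATs of each geometric size. In the ring $\mathbb{Q}[[x,y]]$ of formal power series, let $$\mathfrak{L}(x,y)=\sum_{T\ \mathrm{NAT}}\frac{x^{w_L(T)}}{w_L(T)!}\,\frac{y^{w_R(T)}}{w_R(T)!},\qquad \mathfrak{G}=\partial_x\partial_y\mathfrak{L}.$$ Then $$\mathfrak{L}=x+y-\log\bigl(1-(e^x-1)(e^y-1)\bigr)\qquad\text{and}\qquad \mathfrak{G}=\frac{e^{x+y}}{\bigl(1-(e^x-1)(e^y-1)\bigr)^2}.$$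 -/

import Mathlib

open scoped Nat

/-- The set of vertices of a (possibly empty) binary tree. A vertex is encoded by the path from
the root to it: `false` means going to the left child, `true` going to the right child; the root
is the empty path. -/
def BinaryTree.vertices : BinaryTree Unit → Finset (List Bool)
  | .nil => ∅
  | .node _ l r =>
      insert [] (l.vertices.image (List.cons false) ∪ r.vertices.image (List.cons true))

/-- The left vertices, i.e. the vertices which are a left child. -/
def BinaryTree.leftVertices (t : BinaryTree Unit) : Finset (List Bool) :=
  t.vertices.filter (fun u => u.getLast? = some false)

/-- The right vertices, i.e. the vertices which are a right child. -/
def BinaryTree.rightVertices (t : BinaryTree Unit) : Finset (List Bool) :=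
  t.vertices.filter (fun u => u.getLast? = some true)

/-- Binary trees with two distinct empty trees. A nonempty tree is given by its left and right
subtrees; an empty left (right) subtree of a vertex is always the left (right) empty
tree, so inside a nonempty tree it is written `BinaryTree.nil` without ambiguity. -/
inductive BT : Type
  | emptyL : BT
  | emptyR : BT
  | node (left right : BinaryTree Unit) : BT

namespace BT

/-- The underlying tree, forgetting the difference between the two empty trees. -/
def toTree : BT → BinaryTree Unit
  | emptyL => .nil
  | emptyR => .nil
  | node l r => .node () l r

/-- The first component of the geometric size: `|LV| + 1` for a nonempty tree. -/
def wL : BT → ℕ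
  | emptyL => 0
  | emptyR => 1
  | node l r => (BinaryTree.node () l r).leftVertices.card + 1

/-- The second component of the geometric size: `|RV| + 1` for a nonempty tree. -/
def wR : BT → ℕ
  | emptyL => 1
  | emptyR => 0
  | node l r => (BinaryTree.node () l r).rightVertices.card + 1

end BT

/-- `IsDecreasingLabelling S f`: the labels `f` on the finite set `S` of vertices are pairwise
distinct elements of `{1, …, |S|}`, and the label of a vertex of `S` is strictly greater than the
labels of its proper descendants in `S` (`U` is an ancestor of `V` when the path to `U` is a prefix
of the path to `V`). -/
structure IsDecreasingLabelling (S : Finset (List Bool)) (f : {u // u ∈ S} → ℕ) : Prop where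
  mem_Icc : ∀ u, f u ∈ Finset.Icc 1 S.card
  injective : Function.Injective f
  lt_of_ancestor : ∀ u v, u ≠ v → u.1 <+: v.1 → f v < f u

/-- Non-ambiguous trees of shape `B`. -/
structure NATOfShape (B : BT) where
  leftLabel : {u // u ∈ B.toTree.leftVertices} → ℕ
  rightLabel : {u // u ∈ B.toTree.rightVertices} → ℕ
  left_isDecreasing : IsDecreasingLabelling B.toTree.leftVertices leftLabel
  right_isDecreasing : IsDecreasingLabelling B.toTree.rightVertices rightLabel

/-- Non-ambiguous trees. The two empty shapes carry exactly one (empty) labelling each. -/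
structure NAT where
  shape : BT
  labelling : NATOfShape shape

namespace NAT

noncomputable section

/-- The weight `x ^ wL(T) / wL(T)! * y ^ wR(T) / wR(T)!`, where `x` and `y` are the variables
of index `0` and `1`. -/
def weight (T : NAT) : MvPowerSeries (Fin 2) ℚ :=
  MvPowerSeries.monomial (Finsupp.single 0 T.shape.wL + Finsupp.single 1 T.shape.wR)
    (1 / ((T.shape.wL ! : ℚ) * (T.shape.wR ! : ℚ)))

/-- The generating function `𝔏 = ∑ T, weight T`, the formal sum being taken coefficientwise. -/
def genFun : MvPowerSeries (Fin 2) ℚ :=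
  fun d => ∑ᶠ T : NAT, MvPowerSeries.coeff d T.weight

/-- `𝔊 = ∂ₓ ∂_y 𝔏`. -/
def genFunDeriv : MvPowerSeries (Fin 2) ℚ :=
  MvPowerSeries.pderiv (R := ℚ) 0 (MvPowerSeries.pderiv (R := ℚ) 1 genFun)

/-- The exponential `∑ fⁿ / n!` of a formal power series without constant term. -/
def expOf (f : MvPowerSeries (Fin 2) ℚ) : MvPowerSeries (Fin 2) ℚ :=
  (PowerSeries.exp ℚ).subst f

/-- The logarithm `∑_{n ≥ 1} (-1)^(n+1) (f - 1)ⁿ / n` of a formal power series with constant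
term `1`. -/
def logOf (f : MvPowerSeries (Fin 2) ℚ) : MvPowerSeries (Fin 2) ℚ :=
  (PowerSeries.log ℚ).subst (f - 1)

end

end NAT

/-! Both closed forms come from the equation `∂ₓ∂_y 𝔏 = ∂ₓ𝔏 · ∂_y 𝔏`. By the hook length formula
(`numDecreasing_mul_hookProd`), a nonempty shape `B` contributes to 𝔏 a coefficient `c(B)` such that
`wL · wR · c(B)` is the inverse product of the hooks of its left and of its right vertices. Cutting
`B` at the root into `l` and `r` factors these products (`BT.contribution_node`): `wL(B) wR(B) c(B)
= (wL(r) c(r)) (wR(l) c(l))`, where an empty `l` is `emptyL` and an empty `r` is `emptyR`. As sizes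
add up, summing over shapes gives the equation in Euler form, `x∂ₓ y∂_y 𝔏 = (x∂ₓ𝔏)(y∂_y 𝔏)`.

This equation and the values `x`, `y` on the axes determine a series (`eq_of_euler`). With `D = 1 -
(eˣ-1)(eʸ-1)`, the series `x + y - log D` has partial derivatives `eʸ/D` and `eˣ/D` and satisfies
both conditions. Hence `𝔊 = ∂ₓ𝔏 · ∂_y 𝔏 = eˣeʸ/D²`. -/

namespace MvPowerSeries

/-! ### Substitution and derivations of power series -/

variable {τ : Type*}

theorem coeff_pow_eq_zero_of_degree_lt {R : Type*} [CommRing R] {a : MvPowerSeries τ R}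
    (ha : constantCoeff a = 0) {e : τ →₀ ℕ} {m : ℕ} (h : e.degree < m) :
    coeff e (a ^ m) = 0 := by
  apply coeff_of_lt_order
  have h1 : (1 : ℕ∞) ≤ a.order := by
    rw [Order.one_le_iff_ne_zero]
    exact order_ne_zero_iff_constCoeff_eq_zero.mpr ha
  calc (e.degree : ℕ∞) < m := by exact_mod_cast h
    _ = m • (1 : ℕ∞) := by simp
    _ ≤ m • a.order := by gcongr
    _ ≤ _ := le_order_pow m

/-- Chain rule for the substitution of a multivariate power series in a univariate one. -/
theorem pderiv_subst {R : Type*} [CommRing R] (i : τ) (f : PowerSeries R)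
    {a : MvPowerSeries τ R} (ha : constantCoeff a = 0) :
    pderiv R i (f.subst a) = (PowerSeries.derivative R f).subst a * pderiv R i a := by
  classical
  have hs : PowerSeries.HasSubst a := .of_constantCoeff_zero ha
  have hpoly (p : Polynomial R) : pderiv R i ((p : PowerSeries R).subst a) =
      (PowerSeries.derivative R (p : PowerSeries R)).subst a * pderiv R i a := by
    simp [PowerSeries.subst_coe hs, PowerSeries.derivative_coe,
      Derivation.comp_aeval_eq (a := a) (pderiv R i) p, smul_eq_mul]
  ext n
  -- The coefficients involved have degree at most `n.degree + 1 < m`, and `a ^ d` starts in degree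
  -- `d`. Truncating `f` therefore changes none of them, which reduces the claim to polynomials.
  set m := n.degree + 2 with hm
  have key : coeff (n + Finsupp.single i 1) (f.subst a) =
      coeff (n + Finsupp.single i 1) (((PowerSeries.trunc (m + 1) f : Polynomial R) :
        PowerSeries R).subst a) := by
    rw [PowerSeries.coeff_subst hs, PowerSeries.coeff_subst hs]
    refine finsum_congr fun d ↦ ?_
    obtain hd | hd := lt_or_ge d m
    · rw [PowerSeries.coeff_coe_trunc_of_lt (by lia)]
    · rw [coeff_pow_eq_zero_of_degree_lt ha (by simp [map_add]; lia)]
      simp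
  rw [coeff_pderiv, key, ← coeff_pderiv, hpoly, coeff_mul, coeff_mul]
  refine Finset.sum_congr rfl fun ⟨u, v⟩ huv ↦ ?_
  congr 1
  have hu : u.degree ≤ n.degree := by
    rw [← Finset.HasAntidiagonal.mem_antidiagonal.mp huv]; simp [map_add]
  simp only [PowerSeries.coeff_subst hs, PowerSeries.coeff_derivative, Polynomial.coeff_coe,
    PowerSeries.coeff_trunc]
  refine finsum_congr fun d ↦ ?_
  split_ifs with h
  · rfl
  · rw [coeff_pow_eq_zero_of_degree_lt ha (by lia)]
    simp

theorem derivative_log_subst_mul {a : MvPowerSeries τ ℚ} (ha : constantCoeff a = 0) :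
    (PowerSeries.derivative ℚ (PowerSeries.log ℚ)).subst a * (1 + a) = 1 := by
  have hs : PowerSeries.HasSubst a := .of_constantCoeff_zero ha
  have h1 : PowerSeries.derivative ℚ (PowerSeries.log ℚ) * (1 + PowerSeries.X) = 1 := by
    ext n
    rw [PowerSeries.deriv_log, mul_add, mul_one]
    cases n with
    | zero => simp
    | succ n => simp [PowerSeries.coeff_succ_mul_X, PowerSeries.coeff_one, pow_succ]
  have h2 := congrArg (PowerSeries.substAlgHom (R := ℚ) hs) h1
  simpa [PowerSeries.coe_substAlgHom, PowerSeries.subst_X hs, map_mul, map_add, map_one] using h2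

theorem coeff_subst_eq_zero_of_X_dvd {R : Type*} [CommRing R] {f : PowerSeries R}
    (hf : PowerSeries.constantCoeff f = 0) {a : MvPowerSeries τ R} {s : τ} (hdvd : X s ∣ a)
    {e : τ →₀ ℕ} (he : e s = 0) : coeff e (f.subst a) = 0 := by
  have ha : constantCoeff a = 0 := by
    obtain ⟨b, rfl⟩ := hdvd
    simp
  rw [PowerSeries.coeff_subst (.of_constantCoeff_zero ha), finsum_eq_zero_of_forall_eq_zero]
  intro d
  rcases Nat.eq_zero_or_pos d with rfl | hd
  · simp [hf]
  · rw [(X_dvd_iff.mp (hdvd.trans (dvd_pow_self a hd.ne'))) e he, smul_zero]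

/-- Unlike `∂ₛ`, the Euler operator `xₛ∂ₛ` does not shift exponents, so the differential equation
becomes a convolution over the antidiagonal of `d`. -/
theorem coeff_X_mul_pderiv (s : τ) (f : MvPowerSeries τ ℚ) (d : τ →₀ ℕ) :
    coeff d (X s * pderiv ℚ s f) = d s * coeff d f := by
  classical
  rcases Nat.eq_zero_or_pos (d s) with h | h
  · rw [X_dvd_iff.mp (dvd_mul_right (X s) _) d h, h]; simp
  · obtain ⟨e, rfl⟩ : ∃ e, d = Finsupp.single s 1 + e :=
      ⟨d - Finsupp.single s 1, (add_tsub_cancel_of_le (by simpa [Nat.one_le_iff_ne_zero] using h.ne')).symm⟩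
    rw [X_def, coeff_add_monomial_mul, coeff_pderiv, add_comm e]
    simp; ring

end MvPowerSeries

/-! ### The closed form and its differential equation -/

namespace NAT
open MvPowerSeries

theorem constantCoeff_expOf {f : MvPowerSeries (Fin 2) ℚ} (hf : constantCoeff f = 0) :
    constantCoeff (expOf f) = 1 := by
  have hs : PowerSeries.HasSubst f := .of_constantCoeff_zero hf
  have h := PowerSeries.constantCoeff_subst_eq_zero hf (PowerSeries.exp ℚ - 1) (by simp)
  have h1 : PowerSeries.subst f (1 : PowerSeries ℚ) = 1 := by
    rw [← PowerSeries.coe_substAlgHom hs, map_one]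
  rw [PowerSeries.subst_sub hs, map_sub, h1, map_one, sub_eq_zero] at h
  exact h

theorem pderiv_expOf (i : Fin 2) {f : MvPowerSeries (Fin 2) ℚ} (hf : constantCoeff f = 0) :
    pderiv ℚ i (expOf f) = expOf f * pderiv ℚ i f := by
  rw [expOf, pderiv_subst i _ hf, PowerSeries.derivative_exp]

theorem expOf_X_add_X :
    expOf (X 0 + X 1) = expOf (X 0) * expOf (X 1) := by
  ext e
  simp only [expOf]
  rw [PowerSeries.coeff_subst_X_zero_add_X_one, PowerSeries.coeff_subst_X_zero_subst_mul_X_one,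
    PowerSeries.coeff_exp, PowerSeries.coeff_exp, PowerSeries.coeff_exp, Nat.cast_add_choose]
  simp
  field_simp

theorem X_dvd_expOf_sub_one (s : Fin 2) : X s ∣ expOf (X s) - 1 := by
  have hs : PowerSeries.HasSubst (X s : MvPowerSeries (Fin 2) ℚ) :=
    .of_constantCoeff_zero (by simp)
  obtain ⟨g, hg⟩ : PowerSeries.X ∣ PowerSeries.exp ℚ - 1 :=
    PowerSeries.X_dvd_iff.mpr (by simp)
  refine ⟨g.subst (X s), ?_⟩
  have h := congrArg (PowerSeries.substAlgHom (R := ℚ) hs) hg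
  rwa [map_sub, map_one, map_mul, PowerSeries.substAlgHom_X, PowerSeries.coe_substAlgHom] at h

/-- The argument of the logarithm in the closed form. -/
noncomputable def denom : MvPowerSeries (Fin 2) ℚ := 1 - (expOf (X 0) - 1) * (expOf (X 1) - 1)

/-- The closed form of the generating function. -/
noncomputable def closedForm : MvPowerSeries (Fin 2) ℚ :=
  X 0 + X 1 - logOf denom

theorem constantCoeff_denom : constantCoeff denom = 1 := by
  simp [denom, constantCoeff_expOf]

theorem pderiv_logOf (i : Fin 2) {f : MvPowerSeries (Fin 2) ℚ} (hf : constantCoeff f = 1) :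
    pderiv ℚ i (logOf f) = f⁻¹ * pderiv ℚ i f := by
  have h0 : constantCoeff (f - 1) = 0 := by simp [hf]
  have h1 := derivative_log_subst_mul h0
  rw [add_sub_cancel] at h1
  rw [logOf, pderiv_subst i _ h0, (MvPowerSeries.eq_inv_iff_mul_eq_one (by simp [hf])).mpr h1]
  simp

/-- The numerator of `1 + eˣ(eʸ-1)/D` is `D + eˣ(eʸ-1) = eʸ`. -/
theorem pderiv_zero_closedForm : pderiv ℚ 0 closedForm = expOf (X 1) * denom⁻¹ := by
  have hD : denom * denom⁻¹ = 1 :=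
    MvPowerSeries.mul_inv_cancel _ (by simp [constantCoeff_denom])
  have h : pderiv ℚ 0 closedForm =
      1 - denom⁻¹ * -(expOf (X 0) * (expOf (X 1) - 1)) := by
    rw [closedForm, map_sub, pderiv_logOf 0 constantCoeff_denom, denom]
    simp [pderiv_expOf, mul_comm]
  have hden := denom.eq_1
  rw [h]
  linear_combination denom⁻¹ * hden - hD

theorem pderiv_one_closedForm : pderiv ℚ 1 closedForm = expOf (X 0) * denom⁻¹ := by
  have hD : denom * denom⁻¹ = 1 :=
    MvPowerSeries.mul_inv_cancel _ (by simp [constantCoeff_denom])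
  have h : pderiv ℚ 1 closedForm =
      1 - denom⁻¹ * -(expOf (X 1) * (expOf (X 0) - 1)) := by
    rw [closedForm, map_sub, pderiv_logOf 1 constantCoeff_denom, denom]
    simp [pderiv_expOf, mul_comm]
  have hden := denom.eq_1
  rw [h]
  linear_combination denom⁻¹ * hden - hD

theorem pderiv_pderiv_closedForm :
    pderiv ℚ 0 (pderiv ℚ 1 closedForm) = pderiv ℚ 0 closedForm * pderiv ℚ 1 closedForm := by
  have hD : denom * denom⁻¹ = 1 :=
    MvPowerSeries.mul_inv_cancel _ (by simp [constantCoeff_denom])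
  have hd : pderiv ℚ 0 denom = -(expOf (X 0) * (expOf (X 1) - 1)) := by
    rw [denom]
    simp [pderiv_expOf, mul_comm]
  rw [pderiv_one_closedForm, pderiv_zero_closedForm, Derivation.leibniz, pderiv_inv', hd,
    pderiv_expOf _ (by simp), pderiv_X_self]
  simp only [smul_eq_mul, mul_one]
  calc _ = expOf (X 0) * denom⁻¹ * (denom⁻¹ * (expOf (X 0) * (expOf (X 1) - 1)) +
        denom * denom⁻¹) := by rw [hD]; ring
    _ = _ := by
      -- Only the factor `denom` outside the inverses is expanded; `denom⁻¹` stays an atom for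
      -- `ring`.
      conv_lhs => enter [2, 2, 1]; rw [denom]
      ring

/-- Both variables divide `D - 1`, so `log D` vanishes on the axes. -/
theorem coeff_closedForm_of_eq_zero {d : Fin 2 →₀ ℕ} {s : Fin 2} (hd : d s = 0) :
    coeff d closedForm = coeff d (X 0 + X 1) := by
  have hdvd : X s ∣ denom - 1 := by
    have : denom - 1 = -((expOf (X 0) - 1) * (expOf (X 1) - 1)) := by rw [denom]; ring
    rw [this, dvd_neg]
    fin_cases s
    · exact (X_dvd_expOf_sub_one 0).mul_right _
    · exact (X_dvd_expOf_sub_one 1).mul_left _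
  rw [closedForm, map_sub, logOf,
    coeff_subst_eq_zero_of_X_dvd PowerSeries.constantCoeff_log hdvd hd, sub_zero]

/-- A power series satisfying `∂ₓ∂_y f = ∂ₓf · ∂_yf` (in Euler form) is determined by its
coefficients on the two axes. -/
theorem eq_of_euler {f g : MvPowerSeries (Fin 2) ℚ}
    (hf : ∀ d : Fin 2 →₀ ℕ, (d 0 * d 1 : ℚ) * coeff d f =
      ∑ p ∈ Finset.HasAntidiagonal.antidiagonal d, (p.1 0 * coeff p.1 f) * (p.2 1 * coeff p.2 f))
    (hg : ∀ d : Fin 2 →₀ ℕ, (d 0 * d 1 : ℚ) * coeff d g =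
      ∑ p ∈ Finset.HasAntidiagonal.antidiagonal d, (p.1 0 * coeff p.1 g) * (p.2 1 * coeff p.2 g))
    (hfg : ∀ (d : Fin 2 →₀ ℕ) (s : Fin 2), d s = 0 → coeff d f = coeff d g) : f = g := by
  ext d
  induction hn : d.degree using Nat.strong_induction_on generalizing d with
  | _ n ih =>
  by_cases h0 : d 0 = 0
  · exact hfg d 0 h0
  by_cases h1 : d 1 = 0
  · exact hfg d 1 h1
  have hne : (d 0 * d 1 : ℚ) ≠ 0 := by positivity
  apply mul_left_cancel₀ hne
  rw [hf, hg]
  refine Finset.sum_congr rfl fun p hp ↦ ?_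
  have hdeg : p.1.degree + p.2.degree = n := by
    rw [← hn, ← Finset.HasAntidiagonal.mem_antidiagonal.mp hp, map_add]
  -- A nonzero term has `p.1 0 ≥ 1` and `p.2 1 ≥ 1`, so both exponents have degree less than `n`.
  by_cases hp1 : p.1 0 = 0
  · simp [hp1]
  by_cases hp2 : p.2 1 = 0
  · simp [hp2]
  have h1 := Finsupp.le_degree 0 p.1
  have h2 := Finsupp.le_degree 1 p.2
  rw [ih _ (by lia) p.1 rfl, ih _ (by lia) p.2 rfl]

theorem euler_closedForm (d : Fin 2 →₀ ℕ) : (d 0 * d 1 : ℚ) * coeff d closedForm =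
    ∑ p ∈ Finset.HasAntidiagonal.antidiagonal d,
      (p.1 0 * coeff p.1 closedForm) * (p.2 1 * coeff p.2 closedForm) := by
  have h : X 0 * pderiv ℚ 0 (X 1 * pderiv ℚ 1 closedForm) =
      (X 0 * pderiv ℚ 0 closedForm) * (X 1 * pderiv ℚ 1 closedForm) := by
    rw [Derivation.leibniz, pderiv_X_of_ne (by decide), pderiv_pderiv_closedForm]
    simp only [smul_eq_mul]
    ring
  have h' := congrArg (coeff d) h
  rw [coeff_X_mul_pderiv, coeff_X_mul_pderiv, coeff_mul] at h'
  simp only [coeff_X_mul_pderiv] at h'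
  rw [mul_assoc, h']

end NAT

/-! ### The hook length formula -/

/-- The number of elements of `S` below `u` (including `u`) in the prefix order. -/
def hook (S : Finset (List Bool)) (u : List Bool) : ℕ :=
  (S.filter (u <+: ·)).card

/-- The product of all the hooks of `S`. -/
def hookProd (S : Finset (List Bool)) : ℕ := ∏ u ∈ S, hook S u

/-- The elements of `S` without proper ancestor in `S`. -/
def prefixRoots (S : Finset (List Bool)) : Finset (List Bool) := {u ∈ S | ∀ v ∈ S, v <+: u → v = u}

/-- The number of decreasing labellings of `S`. -/
noncomputable def numDecreasing (S : Finset (List Bool)) : ℕ :=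
  {f : {u // u ∈ S} → ℕ | IsDecreasingLabelling S f}.ncard

theorem prefixRoots_subset (S : Finset (List Bool)) : prefixRoots S ⊆ S := Finset.filter_subset _ _

theorem finite_isDecreasingLabelling (S : Finset (List Bool)) :
    {f : {u // u ∈ S} → ℕ | IsDecreasingLabelling S f}.Finite :=
  (Set.Finite.pi' fun _ ↦ (Finset.Icc 1 S.card).finite_toSet).subset fun _ hf ↦ hf.mem_Icc

/-- Each element lies below exactly one root: its shortest prefix in `S` is one, and two prefixes of
the same path are comparable. -/
theorem sum_hook_prefixRoots (S : Finset (List Bool)) :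
    ∑ u ∈ prefixRoots S, hook S u = S.card := by
  have hS : S = (prefixRoots S).biUnion fun u ↦ {v ∈ S | u <+: v} := by
    ext v
    simp only [Finset.mem_biUnion, Finset.mem_filter, prefixRoots]
    refine ⟨fun hv ↦ ?_, fun ⟨_, _, h⟩ ↦ h.1⟩
    obtain ⟨u, hu, hmin⟩ := Finset.exists_min_image {u ∈ S | u <+: v} List.length ⟨v, by simp [hv]⟩
    rw [Finset.mem_filter] at hu
    refine ⟨u, ⟨hu.1, fun w hw hwu ↦ ?_⟩, hv, hu.2⟩
    exact hwu.eq_of_length_le (hmin w (by simp [hw, hwu.trans hu.2]))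
  conv_rhs => rw [hS]
  rw [Finset.card_biUnion]
  · rfl
  · intro u hu v hv huv
    rw [Function.onFun, Finset.disjoint_left]
    intro w hw hw'
    simp only [Finset.mem_coe, Finset.mem_filter, prefixRoots] at hw hw' hu hv
    rcases List.prefix_or_prefix_of_prefix hw.2 hw'.2 with h | h
    · exact huv (hv.2 u hu.1 h)
    · exact huv (hu.2 v hv.1 h).symm

/-- An injective labelling uses every label, and a proper ancestor of the carrier of the largest one
would need a larger label. -/
theorem IsDecreasingLabelling.exists_eq_card {S : Finset (List Bool)} {f : {u // u ∈ S} → ℕ}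
    (hf : IsDecreasingLabelling S f) (hS : S.Nonempty) :
    ∃ u ∈ prefixRoots S, ∃ h : u ∈ S, f ⟨u, h⟩ = S.card := by
  have himg : Finset.univ.image f = Finset.Icc 1 S.card := by
    apply Finset.eq_of_subset_of_card_le
    · intro k hk
      obtain ⟨u, -, rfl⟩ := Finset.mem_image.mp hk
      exact hf.mem_Icc u
    · rw [Finset.card_image_of_injective _ hf.injective]
      simp
  have hmem : S.card ∈ Finset.univ.image f := by
    rw [himg, Finset.mem_Icc]
    exact ⟨hS.card_pos, le_rfl⟩
  obtain ⟨⟨u, hu⟩, -, huf⟩ := Finset.mem_image.mp hmem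
  refine ⟨u, Finset.mem_filter.mpr ⟨hu, fun v hv hvu ↦ ?_⟩, hu, huf⟩
  by_contra hne
  have h1 := hf.lt_of_ancestor ⟨v, hv⟩ ⟨u, hu⟩ (by simpa using hne) hvu
  have h2 := (Finset.mem_Icc.mp (hf.mem_Icc ⟨v, hv⟩)).2
  lia

/-- Restriction to `S.erase r` is a bijection: giving `r` the top label violates nothing, since `r`
has no proper ancestor in `S`. -/
theorem ncard_isDecreasingLabelling_of_root {S : Finset (List Bool)} {r : List Bool}
    (hr : r ∈ prefixRoots S) :
    {f : {u // u ∈ S} → ℕ | IsDecreasingLabelling S f ∧ ∃ h : r ∈ S, f ⟨r, h⟩ = S.card}.ncard =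
      numDecreasing (S.erase r) := by
  have hrS : r ∈ S := prefixRoots_subset S hr
  have hcard : (S.erase r).card + 1 = S.card := Finset.card_erase_add_one hrS
  refine Set.ncard_congr (fun f _ v ↦ f ⟨v.1, Finset.mem_of_mem_erase v.2⟩) ?_ ?_ ?_
  · rintro f ⟨hf, _, hfr⟩
    refine ⟨fun u ↦ ?_, fun u v huv ↦ ?_, fun u v huv h ↦ ?_⟩
    · have h1 := Finset.mem_Icc.mp (hf.mem_Icc ⟨u.1, Finset.mem_of_mem_erase u.2⟩)
      have h2 : f ⟨u.1, Finset.mem_of_mem_erase u.2⟩ ≠ f ⟨r, hrS⟩ := fun h ↦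
        Finset.ne_of_mem_erase u.2 (congrArg Subtype.val (hf.injective h))
      rw [Finset.mem_Icc]
      lia
    · exact Subtype.ext (Subtype.mk.inj (hf.injective huv))
    · exact hf.lt_of_ancestor _ _ (fun h' ↦ huv (Subtype.ext (Subtype.mk.inj h'))) h
  · rintro f g ⟨-, _, hfr⟩ ⟨-, _, hgr⟩ hfg
    ext ⟨u, hu⟩
    by_cases hur : u = r
    · subst hur
      rw [hfr, hgr]
    · exact congrFun hfg ⟨u, Finset.mem_erase.mpr ⟨hur, hu⟩⟩
  · intro g hg
    have hle (u) : 1 ≤ g u ∧ g u < S.card := by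
      have := Finset.mem_Icc.mp (hg.mem_Icc u)
      lia
    refine ⟨fun u ↦ if h : u.1 = r then S.card else g ⟨u.1, Finset.mem_erase.mpr ⟨h, u.2⟩⟩,
      ⟨⟨?_, ?_, ?_⟩, hrS, by simp⟩, ?_⟩
    · intro u
      rw [Finset.mem_Icc]
      split_ifs with h
      · lia
      · have := hle ⟨u.1, Finset.mem_erase.mpr ⟨h, u.2⟩⟩
        lia
    · intro u v huv
      dsimp only at huv
      split_ifs at huv with h1 h2 h2
      · exact Subtype.ext (h1.trans h2.symm)
      · exact absurd huv (hle _).2.ne'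
      · exact absurd huv (hle _).2.ne
      · exact Subtype.ext (Subtype.mk.inj (hg.injective huv))
    · intro u v huv h
      split_ifs with h1 h2 h2
      · exact absurd (Subtype.ext (h2.trans h1.symm)) huv
      · exact absurd (Subtype.ext ((Finset.mem_filter.mp hr).2 u.1 u.2 (h1 ▸ h) |>.trans h1.symm)) huv
      · exact (hle _).2
      · exact hg.lt_of_ancestor _ _ (fun h' ↦ huv (Subtype.ext (Subtype.mk.inj h'))) h
    · funext u
      simp [Finset.ne_of_mem_erase u.2]

theorem numDecreasing_eq_sum {S : Finset (List Bool)} (hS : S.Nonempty) :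
    numDecreasing S = ∑ r ∈ prefixRoots S, numDecreasing (S.erase r) := by
  have hD : {f : {u // u ∈ S} → ℕ | IsDecreasingLabelling S f} = ⋃ r ∈ prefixRoots S,
      {f | IsDecreasingLabelling S f ∧ ∃ h : r ∈ S, f ⟨r, h⟩ = S.card} := by
    ext f
    simp only [Set.mem_ofPred_eq, Set.mem_iUnion]
    refine ⟨fun hf ↦ ?_, fun ⟨_, _, h⟩ ↦ h.1⟩
    obtain ⟨u, hu, h⟩ := hf.exists_eq_card hS
    exact ⟨u, hu, hf, h⟩
  rw [numDecreasing, hD, ← Finset.set_biUnion_coe,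
    (prefixRoots S).finite_toSet.ncard_biUnion, finsum_mem_coe_finset]
  · exact Finset.sum_congr rfl fun r hr ↦ ncard_isDecreasingLabelling_of_root hr
  · exact fun r _ ↦ (finite_isDecreasingLabelling S).subset fun f hf ↦ hf.1
  · intro r _ s _ hrs
    rw [Function.onFun, Set.disjoint_left]
    rintro f ⟨hf, _, hr⟩ ⟨-, _, hs⟩
    exact hrs (Subtype.mk.inj (hf.injective (hr.trans hs.symm)))

/-- The hook length formula for the forests given by the prefix order. -/
theorem numDecreasing_mul_hookProd (S : Finset (List Bool)) :
    numDecreasing S * hookProd S = S.card ! := by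
  induction hn : S.card generalizing S with
  | zero =>
    obtain rfl := Finset.card_eq_zero.mp hn
    have : {f : {u // u ∈ (∅ : Finset (List Bool))} → ℕ | IsDecreasingLabelling ∅ f} =
        Set.univ := by
      refine Set.eq_univ_of_forall fun f ↦ ⟨?_, ?_, ?_⟩
      · rintro ⟨u, hu⟩; simp at hu
      · rintro ⟨u, hu⟩; simp at hu
      · rintro ⟨u, hu⟩; simp at hu
    simp [numDecreasing, hookProd, this, Set.ncard_univ]
  | succ n ih =>
    have hS : S.Nonempty := Finset.card_pos.mp (by lia)
    -- The factor `|S|` of the factorial is split as the sum of the hooks of the roots. Deleting a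
    -- root `r` changes no other hook, so the terms for `r` agree by induction.
    rw [numDecreasing_eq_sum hS, Finset.sum_mul, Nat.factorial_succ, ← hn,
      ← sum_hook_prefixRoots, Finset.sum_mul]
    refine Finset.sum_congr rfl fun r hr ↦ ?_
    have hrS := prefixRoots_subset S hr
    rw [← ih (S.erase r) (by rw [Finset.card_erase_of_mem hrS, hn]; rfl), hookProd, hookProd,
      ← Finset.mul_prod_erase S _ hrS]
    have h : ∏ u ∈ S.erase r, hook S u = ∏ u ∈ S.erase r, hook (S.erase r) u := by
      refine Finset.prod_congr rfl fun u hu ↦ ?_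
      rw [hook, hook, Finset.filter_erase, Finset.erase_eq_of_notMem]
      rw [Finset.mem_filter]
      rintro ⟨-, h⟩
      exact Finset.ne_of_mem_erase hu
        ((Finset.mem_filter.mp hr).2 u (Finset.mem_of_mem_erase hu) h)
    rw [h]
    ring

theorem numDecreasing_div_factorial (S : Finset (List Bool)) :
    (numDecreasing S : ℚ) / S.card ! = (hookProd S : ℚ)⁻¹ := by
  have h := numDecreasing_mul_hookProd S
  have h0 : (hookProd S : ℚ) ≠ 0 := by
    rw [Nat.cast_ne_zero]
    exact right_ne_zero_of_mul (h ▸ Nat.factorial_ne_zero _)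
  rw [← h, Nat.cast_mul]
  rw [Nat.cast_ne_zero] at h0
  have h1 : (numDecreasing S : ℚ) ≠ 0 := by
    rw [Nat.cast_ne_zero]
    exact left_ne_zero_of_mul (h ▸ Nat.factorial_ne_zero _)
  field_simp

/-! ### Hook products and vertex sets under grafting -/

theorem hookProd_insert_nil {A : Finset (List Bool)} (hA : [] ∉ A) :
    hookProd (insert [] A) = (A.card + 1) * hookProd A := by
  rw [hookProd, Finset.prod_insert hA, hookProd]
  congr 1
  · simp [hook, Finset.card_insert_of_notMem hA]
  · refine Finset.prod_congr rfl fun u hu ↦ ?_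
    have : ¬ u <+: [] := by
      rw [List.prefix_nil]
      rintro rfl
      exact hA hu
    rw [hook, hook, Finset.filter_insert, if_neg this]

/-- The disjoint union of copies of `A` and `B` below the left and the right child of the root. -/
def consUnion (A B : Finset (List Bool)) : Finset (List Bool) :=
  A.image (List.cons false) ∪ B.image (List.cons true)

theorem disjoint_image_cons (A B : Finset (List Bool)) :
    Disjoint (A.image (List.cons false)) (B.image (List.cons true)) := by
  rw [Finset.disjoint_left]
  intro u hu hu'
  obtain ⟨a, -, rfl⟩ := Finset.mem_image.mp hu
  simp at hu'

theorem card_consUnion (A B : Finset (List Bool)) : (consUnion A B).card = A.card + B.card := by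
  rw [consUnion, Finset.card_union_of_disjoint (disjoint_image_cons A B),
    Finset.card_image_of_injective _ List.cons_injective,
    Finset.card_image_of_injective _ List.cons_injective]

theorem hook_consUnion_false (A B : Finset (List Bool)) (u : List Bool) :
    hook (consUnion A B) (false :: u) = hook A u := by
  rw [hook, consUnion, Finset.filter_union, Finset.filter_image, Finset.filter_image]
  simp [List.cons_prefix_cons, Finset.card_image_of_injective _ List.cons_injective, hook]

theorem hook_consUnion_true (A B : Finset (List Bool)) (u : List Bool) :
    hook (consUnion A B) (true :: u) = hook B u := by
  rw [hook, consUnion, Finset.filter_union, Finset.filter_image, Finset.filter_image]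
  simp [List.cons_prefix_cons, Finset.card_image_of_injective _ List.cons_injective, hook]

theorem hookProd_consUnion (A B : Finset (List Bool)) :
    hookProd (consUnion A B) = hookProd A * hookProd B := by
  rw [hookProd]
  conv_lhs => enter [1]; rw [consUnion]
  rw [Finset.prod_union (disjoint_image_cons A B),
    Finset.prod_image List.cons_injective.injOn, Finset.prod_image List.cons_injective.injOn]
  simp only [hook_consUnion_false, hook_consUnion_true, hookProd]

namespace BinaryTree

/-- The vertices of a tree which are left children once the tree is grafted as a left subtree. -/
def graftLeftVertices (t : BinaryTree Unit) : Finset (List Bool) :=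
  t.vertices.filter (fun u => u = [] ∨ u.getLast? = some false)

/-- The vertices of a tree which are right children once the tree is grafted as a right subtree. -/
def graftRightVertices (t : BinaryTree Unit) : Finset (List Bool) :=
  t.vertices.filter (fun u => u = [] ∨ u.getLast? = some true)

theorem leftVertices_nil : (nil : BinaryTree Unit).leftVertices = ∅ := rfl

theorem rightVertices_nil : (nil : BinaryTree Unit).rightVertices = ∅ := rfl

theorem graftLeftVertices_nil : (nil : BinaryTree Unit).graftLeftVertices = ∅ := rfl

theorem graftRightVertices_nil : (nil : BinaryTree Unit).graftRightVertices = ∅ := rfl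

theorem graftLeftVertices_node (l r : BinaryTree Unit) :
    (node () l r).graftLeftVertices = insert [] (node () l r).leftVertices := by
  ext u
  simp only [graftLeftVertices, leftVertices, Finset.mem_filter, Finset.mem_insert, vertices]
  grind

theorem graftRightVertices_node (l r : BinaryTree Unit) :
    (node () l r).graftRightVertices = insert [] (node () l r).rightVertices := by
  ext u
  simp only [graftRightVertices, rightVertices, Finset.mem_filter, Finset.mem_insert, vertices]
  grind

theorem nil_notMem_leftVertices (t : BinaryTree Unit) : [] ∉ t.leftVertices := by
  simp [leftVertices]

theorem nil_notMem_rightVertices (t : BinaryTree Unit) : [] ∉ t.rightVertices := by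
  simp [rightVertices]

theorem getLast?_cons_eq_some_iff (a b : Bool) (u : List Bool) :
    (a :: u).getLast? = some b ↔ (u = [] ∧ a = b) ∨ u.getLast? = some b := by
  cases u <;> simp

/-- The root of `l` becomes a left child, while the root of `r` does not. -/
theorem leftVertices_node (l r : BinaryTree Unit) :
    (node () l r).leftVertices = consUnion l.graftLeftVertices r.leftVertices := by
  ext u
  rcases u with - | ⟨a, u⟩
  · simp [leftVertices, consUnion]
  · cases a <;>
      simp [leftVertices, consUnion, vertices, graftLeftVertices, getLast?_cons_eq_some_iff]

theorem rightVertices_node (l r : BinaryTree Unit) :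
    (node () l r).rightVertices = consUnion l.rightVertices r.graftRightVertices := by
  ext u
  rcases u with - | ⟨a, u⟩
  · simp [rightVertices, consUnion]
  · cases a <;>
      simp [rightVertices, consUnion, vertices, graftRightVertices, getLast?_cons_eq_some_iff]

theorem numNodes_le (t : BinaryTree Unit) :
    t.numNodes ≤ t.leftVertices.card + t.rightVertices.card + 1 := by
  -- The induction needs the grafted counts: the bound for a node uses the first estimate for `l`
  -- and the second for `r`.
  have key : ∀ t : BinaryTree Unit,
      t.numNodes ≤ t.graftLeftVertices.card + t.rightVertices.card ∧
      t.numNodes ≤ t.leftVertices.card + t.graftRightVertices.card ∧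
      t.numNodes ≤ t.leftVertices.card + t.rightVertices.card + 1 := by
    intro t
    induction t with
    | nil => simp
    | node a l r hl hr =>
      cases a
      have h : (node () l r).numNodes ≤
          (node () l r).leftVertices.card + (node () l r).rightVertices.card + 1 := by
        rw [leftVertices_node, rightVertices_node, card_consUnion, card_consUnion, numNodes]
        lia
      rw [graftLeftVertices_node, graftRightVertices_node,
        Finset.card_insert_of_notMem (nil_notMem_leftVertices _),
        Finset.card_insert_of_notMem (nil_notMem_rightVertices _)]
      lia
  exact (key t).2.2

end BinaryTree

/-! ### Geometric sizes and the decomposition at the root -/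

namespace BT

/-- A binary tree seen as a left subtree: an empty one is the left empty tree. -/
def ofLeft : BinaryTree Unit → BT
  | .nil => emptyL
  | .node _ l r => node l r

/-- A binary tree seen as a right subtree: an empty one is the right empty tree. -/
def ofRight : BinaryTree Unit → BT
  | .nil => emptyR
  | .node _ l r => node l r

/-- The geometric size of a tree, as an exponent. -/
noncomputable def size (B : BT) : Fin 2 →₀ ℕ := Finsupp.single 0 B.wL + Finsupp.single 1 B.wR

@[simp] theorem size_zero (B : BT) : B.size 0 = B.wL := by simp [size]

@[simp] theorem size_one (B : BT) : B.size 1 = B.wR := by simp [size]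

theorem wL_ofLeft (t : BinaryTree Unit) : (ofLeft t).wL = t.graftLeftVertices.card := by
  cases t with
  | nil => rfl
  | node a l r =>
    rw [BinaryTree.graftLeftVertices_node,
      Finset.card_insert_of_notMem (BinaryTree.nil_notMem_leftVertices _)]
    rfl

theorem wR_ofLeft (t : BinaryTree Unit) : (ofLeft t).wR = t.rightVertices.card + 1 := by
  cases t <;> rfl

theorem wL_ofRight (t : BinaryTree Unit) : (ofRight t).wL = t.leftVertices.card + 1 := by
  cases t <;> rfl

theorem wR_ofRight (t : BinaryTree Unit) : (ofRight t).wR = t.graftRightVertices.card := by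
  cases t with
  | nil => rfl
  | node a l r =>
    rw [BinaryTree.graftRightVertices_node,
      Finset.card_insert_of_notMem (BinaryTree.nil_notMem_rightVertices _)]
    rfl

theorem wL_node (l r : BinaryTree Unit) :
    (node l r).wL = (ofRight r).wL + (ofLeft l).wL := by
  rw [wL_ofLeft, wL_ofRight, wL, BinaryTree.leftVertices_node, card_consUnion]
  lia

theorem wR_node (l r : BinaryTree Unit) :
    (node l r).wR = (ofRight r).wR + (ofLeft l).wR := by
  rw [wR_ofLeft, wR_ofRight, wR, BinaryTree.rightVertices_node, card_consUnion]
  lia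

/-- The sizes `(0,1)` and `(1,0)` of the empty trees make this hold for empty subtrees too. -/
theorem size_node (l r : BinaryTree Unit) :
    (node l r).size = (ofRight r).size + (ofLeft l).size := by
  rw [size, wL_node, wR_node, Finsupp.single_add, Finsupp.single_add, size, size]
  abel

theorem ofLeft_toTree {B : BT} (h : B.wR ≠ 0) : ofLeft B.toTree = B := by
  cases B <;> first | rfl | exact absurd rfl h

theorem ofRight_toTree {B : BT} (h : B.wL ≠ 0) : ofRight B.toTree = B := by
  cases B <;> first | rfl | exact absurd rfl h

theorem finite_setOf_size (d : Fin 2 →₀ ℕ) : {B : BT | B.size = d}.Finite := by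
  have hfin : (⋃ m ∈ Set.Iic (d 0 + d 1),
      (BinaryTree.treesOfNumNodesEq m : Set (BinaryTree Unit))).Finite :=
    (Set.finite_Iic _).biUnion fun m _ ↦ Finset.finite_toSet _
  -- `emptyR` is the only shape outside the range of `ofLeft`.
  refine ((hfin.image ofLeft).insert emptyR).subset ?_
  rintro B rfl
  simp only [Set.mem_insert_iff, Set.mem_image, Set.mem_iUnion, Set.mem_Iic, Finset.mem_coe,
    BinaryTree.mem_treesOfNumNodesEq]
  cases B with
  | emptyL => exact .inr ⟨.nil, ⟨0, by simp⟩, rfl⟩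
  | emptyR => exact .inl rfl
  | node l r =>
    refine .inr ⟨.node () l r, ⟨_, ?_, rfl⟩, rfl⟩
    have := BinaryTree.numNodes_le (.node () l r)
    simp only [size_zero, size_one, wL, wR]
    lia

/-- The trees of a given size. -/
noncomputable def shapes (d : Fin 2 →₀ ℕ) : Finset BT := (finite_setOf_size d).toFinset

@[simp] theorem mem_shapes {d : Fin 2 →₀ ℕ} {B : BT} : B ∈ shapes d ↔ B.size = d := by
  simp [shapes]

end BT

namespace NATOfShape

/-- A non-ambiguous tree of a given shape is a pair of decreasing labellings. -/
def equivProd (B : BT) : NATOfShape B ≃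
    {f | IsDecreasingLabelling B.toTree.leftVertices f} ×
      {f | IsDecreasingLabelling B.toTree.rightVertices f} where
  toFun T := (⟨T.leftLabel, T.left_isDecreasing⟩, ⟨T.rightLabel, T.right_isDecreasing⟩)
  invFun p := ⟨p.1.1, p.2.1, p.1.2, p.2.2⟩
  left_inv _ := rfl
  right_inv _ := rfl

theorem card_eq (B : BT) : Nat.card (NATOfShape B) =
    numDecreasing B.toTree.leftVertices * numDecreasing B.toTree.rightVertices := by
  rw [Nat.card_congr (equivProd B), Nat.card_prod]
  rfl

instance (B : BT) : Finite (NATOfShape B) := by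
  have := (finite_isDecreasingLabelling B.toTree.leftVertices).to_subtype
  have := (finite_isDecreasingLabelling B.toTree.rightVertices).to_subtype
  exact Finite.of_equiv _ (equivProd B).symm

end NATOfShape

/-! ### Contributions of shapes and their recursion -/

namespace BT

/-- The contribution of all the non-ambiguous trees of shape `B` to the generating function. -/
noncomputable def contribution (B : BT) : ℚ := Nat.card (NATOfShape B) / (B.wL ! * B.wR !)

theorem numDecreasing_empty : numDecreasing ∅ = 1 := by
  simpa [hookProd] using numDecreasing_mul_hookProd ∅

/-- The factors `wL` and `wR` reduce `wL!` and `wR!` to `|LV|!` and `|RV|!`, which the hook length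
formula absorbs. -/
theorem wL_mul_wR_mul_contribution (l r : BinaryTree Unit) :
    (node l r).wL * (node l r).wR * (node l r).contribution =
      (hookProd (BinaryTree.node () l r).leftVertices : ℚ)⁻¹ *
        (hookProd (BinaryTree.node () l r).rightVertices : ℚ)⁻¹ := by
  rw [← numDecreasing_div_factorial, ← numDecreasing_div_factorial, contribution,
    NATOfShape.card_eq, toTree, wL, wR, Nat.factorial_succ, Nat.factorial_succ]
  push_cast
  field_simp

/-- The root of a nonempty grafted tree is a left child with hook `wL`, which accounts for the
missing factor `wL`. -/
theorem wR_mul_contribution_ofLeft (t : BinaryTree Unit) :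
    (ofLeft t).wR * (ofLeft t).contribution =
      (hookProd t.graftLeftVertices : ℚ)⁻¹ * (hookProd t.rightVertices : ℚ)⁻¹ := by
  cases t with
  | nil =>
    simp [ofLeft, contribution, NATOfShape.card_eq, toTree, BinaryTree.leftVertices_nil,
      BinaryTree.rightVertices_nil, BinaryTree.graftLeftVertices_nil, numDecreasing_empty, wL, wR,
      hookProd]
  | node a l r =>
    rw [BinaryTree.graftLeftVertices_node,
      hookProd_insert_nil (BinaryTree.nil_notMem_leftVertices _)]
    have h := wL_mul_wR_mul_contribution l r
    rw [wL] at h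
    push_cast at h ⊢
    rw [mul_inv, mul_assoc, ← h, ofLeft]
    field_simp

theorem wL_mul_contribution_ofRight (t : BinaryTree Unit) :
    (ofRight t).wL * (ofRight t).contribution =
      (hookProd t.leftVertices : ℚ)⁻¹ * (hookProd t.graftRightVertices : ℚ)⁻¹ := by
  cases t with
  | nil =>
    simp [ofRight, contribution, NATOfShape.card_eq, toTree, BinaryTree.leftVertices_nil,
      BinaryTree.rightVertices_nil, BinaryTree.graftRightVertices_nil, numDecreasing_empty, wL, wR,
      hookProd]
  | node a l r =>
    rw [BinaryTree.graftRightVertices_node,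
      hookProd_insert_nil (BinaryTree.nil_notMem_rightVertices _)]
    have h := wL_mul_wR_mul_contribution l r
    rw [wR] at h
    push_cast at h ⊢
    rw [mul_inv, mul_left_comm, ← h, ofRight]
    field_simp

theorem contribution_node (l r : BinaryTree Unit) :
    (node l r).wL * (node l r).wR * (node l r).contribution =
      ((ofRight r).wL * (ofRight r).contribution) *
        ((ofLeft l).wR * (ofLeft l).contribution) := by
  rw [wL_mul_wR_mul_contribution, wR_mul_contribution_ofLeft, wL_mul_contribution_ofRight,
    BinaryTree.leftVertices_node, BinaryTree.rightVertices_node, hookProd_consUnion,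
    hookProd_consUnion]
  push_cast
  rw [mul_inv, mul_inv]
  ring

-- This is the Euler form of `∂ₓ∂_y 𝔏 = ∂ₓ𝔏 · ∂_y 𝔏`, read off at the exponent `d`.
open Finset.HasAntidiagonal in
theorem sum_shapes_contribution (d : Fin 2 →₀ ℕ) :
    (d 0 * d 1 : ℚ) * ∑ B ∈ shapes d, B.contribution = ∑ p ∈ antidiagonal d,
      (p.1 0 * ∑ B ∈ shapes p.1, B.contribution) * (p.2 1 * ∑ B ∈ shapes p.2, B.contribution) := by
  have hL : (d 0 * d 1 : ℚ) * ∑ B ∈ shapes d, B.contribution =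
      ∑ B ∈ shapes d, B.wL * B.wR * B.contribution := by
    rw [Finset.mul_sum]
    refine Finset.sum_congr rfl fun B hB ↦ ?_
    rw [← mem_shapes.mp hB, size_zero, size_one]
  have hR (p : (Fin 2 →₀ ℕ) × (Fin 2 →₀ ℕ)) :
      (p.1 0 * ∑ B ∈ shapes p.1, B.contribution) * (p.2 1 * ∑ B ∈ shapes p.2, B.contribution) =
      ∑ q ∈ shapes p.1 ×ˢ shapes p.2,
        (q.1.wL * q.1.contribution) * (q.2.wR * q.2.contribution) := by
    rw [Finset.mul_sum, Finset.mul_sum, Finset.sum_mul_sum, Finset.sum_product]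
    refine Finset.sum_congr rfl fun B hB ↦ Finset.sum_congr rfl fun C hC ↦ ?_
    rw [← mem_shapes.mp hB, ← mem_shapes.mp hC, size_zero, size_one]
  rw [hL, Finset.sum_congr rfl fun p _ ↦ hR p, Finset.sum_sigma']
  symm
  -- On pairs `(B, C)` the factor `wL` excludes `B = emptyL` and `wR` excludes `C = emptyR`, so `B`
  -- is a right and `C` a left subtree. On the other side `wL * wR` excludes both empty trees.
  refine Finset.sum_bij_ne_zero (fun q _ _ ↦ node q.2.2.toTree q.2.1.toTree) ?_ ?_ ?_ ?_
  · rintro ⟨p, B, C⟩ hq h0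
    have hB : B.wL ≠ 0 := fun h ↦ h0 (by simp [h])
    have hC : C.wR ≠ 0 := fun h ↦ h0 (by simp [h])
    simp only [Finset.mem_sigma, Finset.mem_product, mem_shapes, mem_antidiagonal] at hq
    rw [mem_shapes, size_node, ofRight_toTree hB, ofLeft_toTree hC, hq.2.1, hq.2.2, hq.1]
  · rintro ⟨⟨p, p'⟩, B, C⟩ hq h0 ⟨⟨s, s'⟩, B', C'⟩ hq' h0' h
    have hB : B.wL ≠ 0 := fun h ↦ h0 (by simp [h])
    have hC : C.wR ≠ 0 := fun h ↦ h0 (by simp [h])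
    have hB' : B'.wL ≠ 0 := fun h ↦ h0' (by simp [h])
    have hC' : C'.wR ≠ 0 := fun h ↦ h0' (by simp [h])
    simp only [Finset.mem_sigma, Finset.mem_product, mem_shapes] at hq hq'
    simp only [node.injEq] at h
    obtain rfl : B = B' := by rw [← ofRight_toTree hB, h.2, ofRight_toTree hB']
    obtain rfl : C = C' := by rw [← ofLeft_toTree hC, h.1, ofLeft_toTree hC']
    rw [← hq.2.1, ← hq.2.2, ← hq'.2.1, ← hq'.2.2]
  · rintro B hB h0
    cases B with
    | emptyL => simp [wL] at h0
    | emptyR => simp [wR] at h0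
    | node l r =>
      have hl : (ofLeft l).toTree = l := by cases l <;> rfl
      have hr : (ofRight r).toTree = r := by cases r <;> rfl
      refine ⟨⟨((ofRight r).size, (ofLeft l).size), (ofRight r, ofLeft l)⟩, ?_, ?_, ?_⟩
      · simpa [size_node] using hB
      · rwa [← contribution_node]
      · simp [hl, hr]
  · rintro ⟨p, B, C⟩ hq h0
    have hB : B.wL ≠ 0 := fun h ↦ h0 (by simp [h])
    have hC : C.wR ≠ 0 := fun h ↦ h0 (by simp [h])
    rw [contribution_node, ofRight_toTree hB, ofLeft_toTree hC]

theorem sum_shapes_contribution_of_eq_zero {d : Fin 2 →₀ ℕ} {s : Fin 2} (hd : d s = 0) :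
    ∑ B ∈ shapes d, B.contribution =
      MvPowerSeries.coeff d (MvPowerSeries.X 0 + MvPowerSeries.X 1 : MvPowerSeries (Fin 2) ℚ) := by
  classical
  have hsub : shapes d ⊆ {emptyL, emptyR} := by
    intro B hB
    cases B with
    | emptyL => simp
    | emptyR => simp
    | node l r =>
      rw [← mem_shapes.mp hB] at hd
      fin_cases s <;> simp [wL, wR] at hd
  have hshapes : shapes d = Finset.filter (fun B ↦ B.size = d) {emptyL, emptyR} := by
    ext B
    rw [Finset.mem_filter, mem_shapes]
    exact ⟨fun h ↦ ⟨hsub (mem_shapes.mpr h), h⟩, fun h ↦ h.2⟩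
  rw [hshapes, Finset.sum_filter, Finset.sum_pair (by simp), map_add, MvPowerSeries.coeff_X,
    MvPowerSeries.coeff_X, add_comm]
  simp [contribution, NATOfShape.card_eq, toTree, BinaryTree.leftVertices_nil,
    BinaryTree.rightVertices_nil, numDecreasing_empty, wL, wR, size, eq_comm]

end BT

/-! ### From shapes to the generating function -/

namespace NAT

/-- Non-ambiguous trees of a given size, sorted by shape. -/
def equivSigma (d : Fin 2 →₀ ℕ) : {T : NAT | T.shape.size = d} ≃
    Σ B : {B : BT // B ∈ BT.shapes d}, NATOfShape B.1 where
  toFun T := ⟨⟨T.1.shape, BT.mem_shapes.mpr T.2⟩, T.1.labelling⟩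
  invFun q := ⟨⟨q.1.1, q.2⟩, BT.mem_shapes.mp q.1.2⟩
  left_inv _ := rfl
  right_inv _ := rfl

theorem finite_setOf_size (d : Fin 2 →₀ ℕ) : {T : NAT | T.shape.size = d}.Finite :=
  Set.finite_coe_iff.mp (Finite.of_equiv _ (equivSigma d).symm)

/-- Finitely many trees have size `d`, so the `finsum` is a genuine sum and not the default `0`; it
is grouped by shape. -/
theorem coeff_genFun (d : Fin 2 →₀ ℕ) :
    MvPowerSeries.coeff d genFun = ∑ B ∈ BT.shapes d, B.contribution := by
  classical
  have h1 : MvPowerSeries.coeff d genFun =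
      ∑ᶠ T ∈ {T : NAT | T.shape.size = d}, (1 / ((d 0)! * (d 1)!) : ℚ) := by
    refine finsum_congr fun T ↦ ?_
    rw [weight, MvPowerSeries.coeff_monomial, ← BT.size]
    by_cases h : T.shape.size = d
    · simp [← h]
    · simp [h, Ne.symm h]
  have h2 : {T : NAT | T.shape.size = d}.ncard =
      ∑ B ∈ BT.shapes d, Nat.card (NATOfShape B) := by
    rw [← Nat.card_coe_set_eq, Nat.card_congr (equivSigma d), Nat.card_sigma]
    exact Finset.sum_coe_sort (BT.shapes d) fun B ↦ Nat.card (NATOfShape B)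
  rw [h1, finsum_mem_eq_finite_toFinset_sum _ (finite_setOf_size d), Finset.sum_const,
    ← Set.ncard_eq_toFinset_card _ (finite_setOf_size d), h2, nsmul_eq_mul, Nat.cast_sum, Finset.sum_mul]
  refine Finset.sum_congr rfl fun B hB ↦ ?_
  rw [BT.contribution, ← BT.mem_shapes.mp hB, BT.size_zero, BT.size_one, mul_one_div]

theorem genFun_eq_closedForm : genFun = closedForm := by
  refine eq_of_euler (fun d ↦ ?_) euler_closedForm fun d s hd ↦ ?_
  · simp only [coeff_genFun]
    exact BT.sum_shapes_contribution d
  · rw [coeff_genFun, BT.sum_shapes_contribution_of_eq_zero hd, coeff_closedForm_of_eq_zero hd]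

end NAT

theorem mainTheorem5 (x y : MvPowerSeries (Fin 2) ℚ)
    (hx : x = MvPowerSeries.X 0) (hy : y = MvPowerSeries.X 1) :
    (∀ i j : ℕ, {T : NAT | T.shape.wL = i ∧ T.shape.wR = j}.Finite) ∧
    NAT.genFun = x + y - NAT.logOf (1 - (NAT.expOf x - 1) * (NAT.expOf y - 1)) ∧
    NAT.genFunDeriv =
      NAT.expOf (x + y) * ((1 - (NAT.expOf x - 1) * (NAT.expOf y - 1)) ^ 2)⁻¹ := by
  subst hx hy
  refine ⟨fun i j ↦ ?_, NAT.genFun_eq_closedForm, ?_⟩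
  · refine (NAT.finite_setOf_size (Finsupp.single 0 i + Finsupp.single 1 j)).subset ?_
    rintro T ⟨rfl, rfl⟩
    rfl
  · rw [NAT.genFunDeriv, NAT.genFun_eq_closedForm, NAT.pderiv_pderiv_closedForm,
      NAT.pderiv_zero_closedForm, NAT.pderiv_one_closedForm, NAT.expOf_X_add_X, ← NAT.denom, sq,
      MvPowerSeries.mul_inv_rev]
    ring
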